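/- Setting. Write a point of Minkowski space $\mathbb R^4$ as $x=(x_q,x_c)\in\mathbb R^2\times\mathbb R^2$ with $x_q=(x^0,x^1)$, $x_c=(x^2,x^3)$. Let $\mathscr H=L^2(\mathbb R^3, d^3p/(2\|p\|))$ be the one-particle space of the free massless scalar field, and let $\mathscr H_F=\bigoplus_{n\ge0}\mathscr H^{\otimes_s n}$ be its bosonic Fock space, with coherent vectors $e^{g}=\bigoplus_n g^{\otimes n}/\sqrt{n!}$ and vacuum $\Omega=e^0$. For $h\in\mathscr H$ let $W(h)$ be the Weyl operator, that is, the unitary operator on $\mathscr H_F$ with $W(h)e^{g}=\exp\bigl(-\tfrac12\|h\|^2+i\langle h,g\rangle\bigr)e^{g+ih}$ for all $g\in\mathscr H$ (inner product conjugate-linear in the first argument). For a real function $u$ on $\mathbb R^4$ put $(Eu)(p)=\sqrt{2\pi}\,\hat u(\|p\|,p)$, where $\hat u(k)=(2\pi)^{-2}\int u(x)e^{-ik^\mu x_\mu}\,d^4x$ and $k^\mu x_\mu=k^0x^0-k^1x^1-k^2x^2-k^3x^3$. Let $\sigma^{\rm std}$ be the $4\times4$ matrix $J\oplus 0_2$ with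 $J=\begin{pmatrix}0&-1\\1&0\end{pmatrix}$, and put $\|\sigma\|^2=\tfrac14\operatorname{Tr}(\sigma^T\sigma)$. For $\xi\in\mathbb R^2$ and a non-negative $f\in C_c^\infty(\mathbb R^2)$ with $\int f=1$ let $\omega=\omega_{f,\xi}$ be the localized state with test function $$\psi_{\omega}(x)=f(x_c)\,\frac1{2\pi\|\sigma^{\rm std}\|}\,e^{-\|x_q-\xi\|_2^2/(2\|\sigma^{\rm std}\|)} .$$ For $x_q\in\mathbb R^2$ and bounded $D\subset\mathbb R^2$ the field algebra is the von Neumann algebra $$F(\{x_q\}\times D)=\{W(E\psi_{\omega_{f,\xi}})\mid \xi=x_q,\ \operatorname{supp} f\subset D\}''$$ on $\mathscr H_F$. Let $\Sigma_0$ be the set of non-zero real skew-symmetric $4\times4$ matrices whose electric and magnetic parts are orthogonal and of equal norm, let $\mathcal R$ be the family of triples $R=(\sigma,x_q,D)$ with $\sigma\in\Sigma_0$, $x_q\in\mathbb R^2$ and $D\subset\mathbb R^2$ bounded, and put $\pi(R)=\{x_q\}\times D$. Proposition. For every $R\in\mathcal R$ the vacuum $\Omega$ is separating but not cyclic for $F(\pi(R))$: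 if $a\in F(\pi(R))$ and $a\Omega=0$ then $a=0$, while $F(\pi(R))\Omega$ is not dense in $\mathscr H_F$. -/

import Mathlib

open MeasureTheory

noncomputable section

namespace ScaleCov

section Fock

variable {X : Type*} [MeasurableSpace X] (μ : Measure X) [SigmaFinite μ]

theorem measurePreserving_perm (n : ℕ) (e : Equiv.Perm (Fin n)) :
    MeasurePreserving (fun (x : Fin n → X) (i : Fin n) => x (e i))
      (Measure.pi fun _ => μ) (Measure.pi fun _ => μ) := by
  have h := measurePreserving_piCongrLeft (α := fun _ : Fin n => X) (fun _ => μ) e.symm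
  have h2 : (MeasurableEquiv.piCongrLeft (fun _ : Fin n => X) e.symm : (Fin n → X) → (Fin n → X))
      = fun (x : Fin n → X) (i : Fin n) => x (e i) := by
    funext x i
    have := Equiv.piCongrLeft_apply_apply (P := fun _ : Fin n => X) e.symm x (e i)
    simpa [MeasurableEquiv.coe_piCongrLeft] using this
  rw [h2] at h
  exact h

/-- The `n`-particle space: square-integrable functions of `n` variables which are invariant
under all permutations of the variables (up to null sets). -/
def symmetricL2 (n : ℕ) : Submodule ℂ (Lp ℂ 2 (Measure.pi fun _ : Fin n => μ)) where
  carrier := {F | ∀ e : Equiv.Perm (Fin n),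
    Lp.compMeasurePreserving _ (measurePreserving_perm μ n e) F = F}
  zero_mem' := fun e => map_zero _
  add_mem' := fun {F G} hF hG e => by rw [map_add, hF e, hG e]
  smul_mem' := fun c F hF e => by
    have := (Lp.compMeasurePreservingₗ ℂ _ (measurePreserving_perm μ n e)).map_smul c F
    exact this.trans (congrArg (c • ·) (hF e))

theorem isClosed_symmetricL2 (n : ℕ) :
    IsClosed (symmetricL2 μ n : Set (Lp ℂ 2 (Measure.pi fun _ : Fin n => μ))) := by
  have : (symmetricL2 μ n : Set (Lp ℂ 2 (Measure.pi fun _ : Fin n => μ))) =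
      ⋂ e : Equiv.Perm (Fin n),
        {F | Lp.compMeasurePreserving _ (measurePreserving_perm μ n e) F = F} := by
    ext F
    simp only [Set.mem_iInter]
    exact Iff.rfl
  rw [this]
  exact isClosed_iInter fun e =>
    isClosed_eq (Lp.isometry_compMeasurePreserving _).continuous continuous_id

instance completeSpace_symmetricL2 (n : ℕ) : CompleteSpace (symmetricL2 μ n) :=
  (isClosed_symmetricL2 μ n).completeSpace_coe

/-- The bosonic Fock space over `L²(X, μ)`: the Hilbert space direct sum over `n` of the
symmetric `n`-particle spaces. -/
abbrev FockSpace : Type _ := lp (fun n : ℕ => symmetricL2 μ n) 2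

variable {μ}

theorem memLp_prod {n : ℕ} (f : Fin n → Lp ℂ 2 μ) :
    MemLp (fun x : Fin n → X => ∏ i, f i (x i)) 2 (Measure.pi fun _ => μ) := by
  have hm : AEStronglyMeasurable (fun x : Fin n → X => ∏ i, f i (x i))
      (Measure.pi fun _ => μ) := by
    refine Finset.aestronglyMeasurable_fun_prod _ fun i _ => ?_
    exact (Lp.aestronglyMeasurable (f i)).comp_quasiMeasurePreserving
      (Measure.quasiMeasurePreserving_eval (fun _ => μ) i)
  rw [memLp_two_iff_integrable_sq_norm hm]
  have := Integrable.fintype_prod (ι := Fin n) (𝕜 := ℝ) (μ := fun _ => μ)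
    (f := fun i x => ‖f i x‖ ^ 2)
    (fun i => (memLp_two_iff_integrable_sq_norm (Lp.aestronglyMeasurable (f i))).1 (Lp.memLp (f i)))
  simpa [norm_prod, Finset.prod_pow] using this

/-- The `n`-fold tensor power `f ⊗ ⋯ ⊗ f`, that is `(x₁, …, xₙ) ↦ f x₁ * ⋯ * f xₙ`. -/
def tensorPow (f : Lp ℂ 2 μ) (n : ℕ) : symmetricL2 μ n :=
  ⟨(memLp_prod fun _ : Fin n => f).toLp _, fun e => by
    rw [Lp.toLp_compMeasurePreserving]
    congr 1
    funext x
    exact Equiv.prod_comp e fun i => f (x i)⟩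

theorem inner_toLp_prod {n : ℕ} (f g : Fin n → Lp ℂ 2 μ) :
    inner ℂ ((memLp_prod f).toLp _) ((memLp_prod g).toLp _) = ∏ i, inner ℂ (f i) (g i) := by
  simp_rw [L2.inner_def]
  rw [← integral_fintype_prod_eq_prod (𝕜 := ℂ) (μ := fun _ => μ)
    (f := fun i x => inner ℂ (f i x) (g i x))]
  refine integral_congr_ae ?_
  filter_upwards [(memLp_prod f).coeFn_toLp, (memLp_prod g).coeFn_toLp] with x h1 h2
  rw [h1, h2]
  simp [RCLike.inner_apply, Finset.prod_mul_distrib]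

theorem inner_tensorPow (f g : Lp ℂ 2 μ) (n : ℕ) :
    inner ℂ (tensorPow f n) (tensorPow g n) = (inner ℂ f g : ℂ) ^ n := by
  rw [Submodule.coe_inner, tensorPow, tensorPow, inner_toLp_prod]
  simp

theorem norm_tensorPow (f : Lp ℂ 2 μ) (n : ℕ) : ‖tensorPow f n‖ = ‖f‖ ^ n := by
  have h := (inner_self_eq_norm_sq_to_K (𝕜 := ℂ) (tensorPow f n)).symm.trans (inner_tensorPow f f n)
  rw [inner_self_eq_norm_sq_to_K] at h
  have h' : ‖tensorPow f n‖ ^ 2 = (‖f‖ ^ n) ^ 2 := by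
    rw [← pow_mul, mul_comm, pow_mul]; exact_mod_cast h
  exact (pow_left_inj₀ (norm_nonneg _) (by positivity) two_ne_zero).1 h'

/-- The coherent vector `e^f = ⊕ₙ f^{⊗n} / √(n!)`. -/
def coherent (f : Lp ℂ 2 μ) : FockSpace μ :=
  ⟨fun n => ((Real.sqrt (n.factorial : ℝ))⁻¹ : ℂ) • tensorPow f n, by
    refine memℓp_gen ?_
    have : ∀ n : ℕ, ‖((Real.sqrt (n.factorial : ℝ))⁻¹ : ℂ) • tensorPow f n‖
        ^ (2 : ENNReal).toReal = (‖f‖ ^ 2) ^ n / n.factorial := fun n => by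
      rw [norm_smul, norm_tensorPow]
      have h : (0 : ℝ) ≤ (n.factorial : ℝ) := by positivity
      simp only [norm_inv, Complex.norm_real, Real.norm_eq_abs, abs_of_nonneg (Real.sqrt_nonneg _)]
      rw [ENNReal.toReal_ofNat, Real.rpow_two, mul_pow, inv_pow, Real.sq_sqrt h]
      ring
    simp_rw [this]
    exact Real.summable_pow_div_factorial _⟩

theorem inner_coherent (f g : Lp ℂ 2 μ) :
    inner ℂ (coherent f) (coherent g) = Complex.exp (inner ℂ f g) := by
  rw [lp.inner_eq_tsum, Complex.exp_eq_exp_ℂ, NormedSpace.exp_eq_tsum_div]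
  refine tsum_congr fun n => ?_
  simp only [coherent]
  refine (inner_smul_left (𝕜 := ℂ) (tensorPow f n) _ _).trans ?_
  refine (congrArg _ (inner_smul_right (𝕜 := ℂ) (tensorPow f n) (tensorPow g n) _)).trans ?_
  rw [inner_tensorPow]
  have h : (0 : ℝ) ≤ (n.factorial : ℝ) := by positivity
  have h2 : ((Real.sqrt (n.factorial : ℝ) : ℂ)⁻¹) * ((Real.sqrt (n.factorial : ℝ) : ℂ)⁻¹)
      = ((n.factorial : ℂ))⁻¹ := by
    rw [← mul_inv, ← Complex.ofReal_mul, Real.mul_self_sqrt h]; simp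
  rw [map_inv₀, Complex.conj_ofReal, ← mul_assoc, h2]
  field_simp

/-- A square-integrable function on `Xⁿ` which is orthogonal to all products is zero. -/
theorem eq_zero_of_inner_prod {n : ℕ} (F : Lp ℂ 2 (Measure.pi fun _ : Fin n => μ))
    (h : ∀ f : Fin n → Lp ℂ 2 μ, inner ℂ ((memLp_prod f).toLp _) F = 0) : F = 0 := by
  classical
  let ν : Measure (Fin n → X) := Measure.pi fun _ => μ
  have hν : ν = Measure.pi fun _ => μ := rfl
  -- integrals over boxes vanish
  have hbox : ∀ A : Fin n → Set X, (∀ i, MeasurableSet (A i)) → (∀ i, μ (A i) ≠ ⊤) →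
      ∫ x in Set.univ.pi A, F x ∂ν = 0 := by
    intro A hA hfin
    have h1 := h fun i => indicatorConstLp 2 (hA i) (hfin i) (1 : ℂ)
    rw [L2.inner_def] at h1
    rw [← h1, ← integral_indicator (MeasurableSet.univ_pi hA)]
    refine integral_congr_ae ?_
    have h2 : ∀ i, ∀ᵐ x ∂ν, (indicatorConstLp 2 (hA i) (hfin i) (1 : ℂ)) (x i)
        = (A i).indicator (fun _ => (1 : ℂ)) (x i) := fun i =>
      (Measure.quasiMeasurePreserving_eval (fun _ : Fin n => μ) i).ae
        (indicatorConstLp_coeFn (p := 2) (hs := hA i) (hμs := hfin i) (c := (1 : ℂ)))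
    filter_upwards [(memLp_prod fun i => indicatorConstLp 2 (hA i) (hfin i) (1 : ℂ)).coeFn_toLp,
      ae_all_iff.2 h2] with x hx1 hx2
    rw [hx1]
    simp only [hx2]
    by_cases hx : x ∈ Set.univ.pi A
    · have : ∀ i, x i ∈ A i := fun i => hx i (Set.mem_univ i)
      simp [Set.indicator_of_mem hx, Set.indicator_of_mem (this _)]
    · obtain ⟨i, hi⟩ : ∃ i, x i ∉ A i := by
        by_contra hc; push Not at hc; exact hx fun i _ => hc i
      rw [Set.indicator_of_notMem hx, Finset.prod_eq_zero (Finset.mem_univ i)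
        (Set.indicator_of_notMem hi _)]
      simp
  -- exhaustion by boxes of finite measure
  let B : ℕ → Set (Fin n → X) := fun k => Set.univ.pi fun _ => spanningSets μ k
  have hBm : ∀ k, MeasurableSet (B k) := fun k =>
    MeasurableSet.univ_pi fun _ => measurableSet_spanningSets μ k
  have hBfin : ∀ k, ν (B k) < ⊤ := fun k => by
    rw [hν, Measure.pi_pi]
    exact ENNReal.prod_lt_top fun _ _ => measure_spanningSets_lt_top μ k
  have hBint : ∀ k, IntegrableOn F (B k) ν := fun k => by
    have : IsFiniteMeasure (ν.restrict (B k)) := ⟨by simpa using hBfin k⟩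
    exact ((Lp.memLp F).restrict (B k)).integrable (by norm_num)
  have hB : ∀ k, ∀ᵐ x ∂ν, x ∈ B k → F x = 0 := fun k => by
    rw [← ae_restrict_iff' (hBm k)]
    refine (hBint k).ae_eq_zero_of_forall_setIntegral_eq_zero fun s hs _ => ?_
    induction s, hs using MeasurableSpace.induction_on_inter (generateFrom_pi (α := fun _ : Fin n => X)).symm
      isPiSystem_pi with
    | empty => simp
    | basic t ht =>
      obtain ⟨A, hA, rfl⟩ := ht
      have hA' : ∀ i, MeasurableSet (A i) := fun i => hA i (Set.mem_univ i)
      rw [Measure.restrict_restrict (MeasurableSet.univ_pi hA'), ← Set.pi_inter_distrib]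
      exact hbox _ (fun i => (hA' i).inter (measurableSet_spanningSets μ k)) fun i =>
        ne_top_of_le_ne_top (measure_spanningSets_lt_top μ k).ne
          (measure_mono Set.inter_subset_right)
    | compl t ht ih =>
      have h1 := integral_add_compl ht (hBint k)
      have h2 : ∫ x in B k, F x ∂ν = 0 :=
        hbox _ (fun _ => measurableSet_spanningSets μ k)
          fun _ => (measure_spanningSets_lt_top μ k).ne
      rw [h2] at h1
      have ih' := ih (measure_lt_top_of_subset (Set.subset_univ t) (by simpa using (hBfin k).ne))
      rwa [ih', zero_add] at h1
    | iUnion t hd ht ih =>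
      rw [integral_iUnion ht hd (hBint k).integrableOn]
      have : ∀ i, ∫ x in t i, F x ∂(ν.restrict (B k)) = 0 := fun i =>
        ih i (measure_lt_top_of_subset (Set.subset_univ _) (by simpa using (hBfin k).ne))
      simp [this]
  rw [Lp.eq_zero_iff_ae_eq_zero]
  filter_upwards [ae_all_iff.2 hB] with x hx
  obtain ⟨k, hk⟩ : ∃ k, x ∈ B k := by
    refine ⟨Finset.univ.sup fun i => spanningSetsIndex μ (x i), fun i _ => ?_⟩
    exact monotone_spanningSets μ (Finset.le_sup (f := fun i => spanningSetsIndex μ (x i))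
      (Finset.mem_univ i)) (mem_spanningSetsIndex μ (x i))
  exact hx k hk

/-- Polarization: a symmetric function orthogonal to all tensor powers is zero. -/
theorem eq_zero_of_inner_tensorPow {n : ℕ} (F : symmetricL2 μ n)
    (h : ∀ f : Lp ℂ 2 μ, inner ℂ (tensorPow f n) F = 0) : F = 0 := by
  classical
  refine Subtype.ext (eq_zero_of_inner_prod _ fun f => ?_)
  let b : (Fin n → Fin n) → ℂ := fun α => inner ℂ ((memLp_prod fun i => f (α i)).toLp _) F.1
  -- expansion of the tensor power of a linear combination
  have hexp : ∀ c : Fin n → ℂ, ∑ α : Fin n → Fin n, (∏ i, c (α i)) * b α = 0 := by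
    intro c
    have h0 : inner ℂ ((memLp_prod fun _ : Fin n => ∑ j, (starRingEnd ℂ (c j)) • f j).toLp _) F.1
        = 0 := h (∑ j, (starRingEnd ℂ (c j)) • f j)
    have : (memLp_prod fun _ : Fin n => ∑ j, (starRingEnd ℂ (c j)) • f j).toLp _ =
        ∑ α : Fin n → Fin n, (∏ i, starRingEnd ℂ (c (α i))) •
          (memLp_prod fun i => f (α i)).toLp _ := by
      refine Lp.ext ?_
      have e1 : ∀ i : Fin n, ∀ᵐ x ∂(Measure.pi fun _ : Fin n => μ),
          (∑ j, (starRingEnd ℂ (c j)) • f j : Lp ℂ 2 μ) (x i)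
            = ∑ j, starRingEnd ℂ (c j) * f j (x i) := fun i => by
        have a1 := Lp.coeFn_finsetSum (p := 2) (μ := μ) Finset.univ fun j => (starRingEnd ℂ (c j)) • f j
        have a2 := ae_all_iff.2 fun j => Lp.coeFn_smul (p := 2) (starRingEnd ℂ (c j)) (f j)
        have a0 : ∀ᵐ y ∂μ, (∑ j, (starRingEnd ℂ (c j)) • f j : Lp ℂ 2 μ) y
            = ∑ j, starRingEnd ℂ (c j) * f j y := by
          filter_upwards [a1, a2] with y h1 h2
          rw [h1, Finset.sum_apply]
          exact Finset.sum_congr rfl fun j _ => h2 j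
        exact (Measure.quasiMeasurePreserving_eval (fun _ : Fin n => μ) i).ae a0
      have a3 := Lp.coeFn_finsetSum (p := 2) (μ := Measure.pi fun _ : Fin n => μ) Finset.univ
        fun α : Fin n → Fin n => (∏ i, starRingEnd ℂ (c (α i))) •
          (memLp_prod fun i => f (α i)).toLp _
      have a4 := ae_all_iff.2 fun α : Fin n → Fin n => Lp.coeFn_smul (p := 2)
        (∏ i, starRingEnd ℂ (c (α i))) ((memLp_prod fun i => f (α i)).toLp _)
      have a5 := ae_all_iff.2 fun α : Fin n → Fin n => (memLp_prod fun i => f (α i)).coeFn_toLp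
      filter_upwards [(memLp_prod fun _ : Fin n =>
        ∑ j, (starRingEnd ℂ (c j)) • f j).coeFn_toLp, ae_all_iff.2 e1, a3, a4, a5]
        with x h1 h2 h3 h4 h5
      rw [h1, h3, Finset.sum_apply]
      simp only [h2, h4, Pi.smul_apply, h5, smul_eq_mul]
      rw [Finset.prod_univ_sum]
      simp [Finset.prod_mul_distrib]
    rw [this, sum_inner] at h0
    rw [← h0]
    refine Finset.sum_congr rfl fun α _ => ?_
    rw [inner_smul_left, map_prod]
    simp [b]
  -- the coefficient of `c 0 * ⋯ * c (n-1)` in this polynomial identity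
  let P : MvPolynomial (Fin n) ℂ :=
    ∑ α : Fin n → Fin n, MvPolynomial.C (b α) * ∏ i, MvPolynomial.X (α i)
  have hP : P = 0 := MvPolynomial.funext fun c => by
    simp only [P, map_sum, map_mul, map_prod, MvPolynomial.eval_C, MvPolynomial.eval_X, map_zero]
    rw [← hexp c]
    exact Finset.sum_congr rfl fun α _ => mul_comm _ _
  have hmon : ∀ α : Fin n → Fin n, (∏ i, (MvPolynomial.X (α i) : MvPolynomial (Fin n) ℂ)) =
      MvPolynomial.monomial (∑ i, Finsupp.single (α i) 1) 1 := fun α => by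
    rw [MvPolynomial.monomial_sum_one]; rfl
  have hcoef := congrArg (MvPolynomial.coeff (∑ i : Fin n, Finsupp.single i 1)) hP
  simp only [P, MvPolynomial.coeff_sum, MvPolynomial.coeff_C_mul, hmon,
    MvPolynomial.coeff_monomial, MvPolynomial.coeff_zero] at hcoef
  have hcond : ∀ α : Fin n → Fin n,
      (∑ i, Finsupp.single (α i) (1 : ℕ)) = (∑ i : Fin n, Finsupp.single i 1) ↔
        Function.Bijective α := by
    intro α
    constructor
    · intro hα
      refine (Finite.injective_iff_bijective).1 (Finite.injective_iff_surjective.2 fun j => ?_)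
      have := DFunLike.congr_fun hα j
      simp only [Finsupp.coe_finsetSum, Finset.sum_apply, Finsupp.single_apply] at this
      by_contra hc
      push Not at hc
      simp [hc] at this
    · intro hα
      exact (Equiv.ofBijective α hα).sum_comp fun i => Finsupp.single i (1 : ℕ)
  -- all permutations contribute equally
  have hperm : ∀ α : Fin n → Fin n, Function.Bijective α → b α = b id := by
    intro α hα
    let e : Equiv.Perm (Fin n) := (Equiv.ofBijective α hα)
    have h1 : Lp.compMeasurePreserving _ (measurePreserving_perm μ n e)
        ((memLp_prod fun i => f (α i)).toLp _) = (memLp_prod f).toLp _ := by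
      rw [Lp.toLp_compMeasurePreserving]
      congr 1
      funext x
      exact Equiv.prod_comp e fun i => f i (x i)
    have h2 := (Lp.compMeasurePreservingₗᵢ ℂ _ (measurePreserving_perm μ n e)).inner_map_map
      ((memLp_prod fun i => f (α i)).toLp _) F.1
    have h3 : Lp.compMeasurePreservingₗᵢ ℂ _ (measurePreserving_perm μ n e) F.1 = F.1 := F.2 e
    rw [h3] at h2
    exact h2.symm.trans (congrArg (fun G => inner ℂ G F.1) h1)
  have hsum : ∑ α : Fin n → Fin n, (b α * if (∑ i, Finsupp.single (α i) (1 : ℕ)) =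
      (∑ i : Fin n, Finsupp.single i 1) then (1 : ℂ) else 0) =
      (Finset.univ.filter fun α : Fin n → Fin n => Function.Bijective α).card * b id := by
    rw [← nsmul_eq_mul, ← Finset.sum_const, Finset.sum_filter]
    refine Finset.sum_congr rfl fun α _ => ?_
    by_cases hα : Function.Bijective α
    · rw [if_pos ((hcond α).2 hα), if_pos hα, mul_one, hperm α hα]
    · rw [if_neg (mt (hcond α).1 hα), if_neg hα, mul_zero]
  rw [hsum] at hcoef
  rcases mul_eq_zero.1 hcoef with h1 | h1
  · exfalso
    have : (Finset.univ.filter fun α : Fin n → Fin n => Function.Bijective α).card ≠ 0 :=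
      Finset.card_ne_zero_of_mem (Finset.mem_filter.2 ⟨Finset.mem_univ id, Function.bijective_id⟩)
    exact this (by exact_mod_cast h1)
  · exact h1

theorem tensorPow_smul (c : ℂ) (f : Lp ℂ 2 μ) (n : ℕ) :
    tensorPow (c • f) n = c ^ n • tensorPow f n := by
  refine Subtype.ext (Lp.ext ?_)
  have h1 : ∀ i : Fin n, ∀ᵐ x ∂(Measure.pi fun _ : Fin n => μ), (c • f) (x i) = c * f (x i) :=
    fun i => (Measure.quasiMeasurePreserving_eval (fun _ : Fin n => μ) i).ae (Lp.coeFn_smul c f)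
  filter_upwards [(memLp_prod fun _ : Fin n => c • f).coeFn_toLp,
    (memLp_prod fun _ : Fin n => f).coeFn_toLp, ae_all_iff.2 h1,
    Lp.coeFn_smul (p := 2) (c ^ n) ((memLp_prod fun _ : Fin n => f).toLp _)] with x a b d e
  refine a.trans (Eq.trans ?_ e.symm)
  rw [Pi.smul_apply, b]
  simp [d, Finset.prod_mul_distrib]

/-- A vector of the Fock space orthogonal to all coherent vectors is zero. -/
theorem eq_zero_of_inner_coherent (Ψ : FockSpace μ)
    (h : ∀ f : Lp ℂ 2 μ, inner ℂ (coherent f) Ψ = 0) : Ψ = 0 := by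
  refine lp.ext (funext fun n => eq_zero_of_inner_tensorPow _ fun f => ?_)
  let a : ℕ → ℂ := fun n => ((Real.sqrt (n.factorial : ℝ))⁻¹ : ℂ) * inner ℂ (tensorPow f n) (Ψ n)
  have hs : ∀ z : ℂ, HasSum (fun n => z ^ n • a n) 0 := fun z => by
    have h1 := lp.hasSum_inner (𝕜 := ℂ) (coherent ((starRingEnd ℂ z) • f)) Ψ
    rw [h] at h1
    refine h1.congr_fun fun n => ?_
    refine Eq.trans ?_ (inner_smul_left (𝕜 := ℂ) (tensorPow ((starRingEnd ℂ z) • f) n) (Ψ n)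
      ((Real.sqrt (n.factorial : ℝ))⁻¹ : ℂ)).symm
    rw [tensorPow_smul]
    refine Eq.trans ?_ (congrArg _ (inner_smul_left (𝕜 := ℂ) (tensorPow f n) (Ψ n)
      ((starRingEnd ℂ z) ^ n)).symm)
    simp only [map_inv₀, Complex.conj_ofReal, map_pow, Complex.conj_conj, smul_eq_mul, a]
    ring
  have hp : HasFPowerSeriesAt (0 : ℂ → ℂ) (FormalMultilinearSeries.ofScalars ℂ a) 0 := by
    rw [hasFPowerSeriesAt_iff]
    refine Filter.Eventually.of_forall fun z => ?_
    simpa [FormalMultilinearSeries.coeff_ofScalars] using hs z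
  have h0 := congrArg (fun p => FormalMultilinearSeries.coeff p n) hp.eq_zero
  simp only [FormalMultilinearSeries.coeff_ofScalars] at h0
  have h1 : a n = 0 := by rw [h0]; simp [FormalMultilinearSeries.coeff]
  refine (mul_eq_zero.1 h1).resolve_left ?_
  have : 0 < Real.sqrt (n.factorial : ℝ) := Real.sqrt_pos.2 (by positivity)
  exact inv_ne_zero (by exact_mod_cast this.ne')

/-- The coherent vectors are total in the Fock space. -/
theorem denseRange_coherent :
    DenseRange (Finsupp.linearCombination ℂ (coherent : Lp ℂ 2 μ → FockSpace μ)) := by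
  have : Dense ((LinearMap.range (Finsupp.linearCombination ℂ
      (coherent : Lp ℂ 2 μ → FockSpace μ)) : Submodule ℂ (FockSpace μ)) : Set (FockSpace μ)) := by
    rw [Submodule.dense_iff_topologicalClosure_eq_top, Submodule.topologicalClosure_eq_top_iff,
      Submodule.eq_bot_iff]
    intro Ψ hΨ
    refine eq_zero_of_inner_coherent Ψ fun f => ?_
    exact (Submodule.mem_orthogonal _ _).1 hΨ _ ⟨Finsupp.single f 1, by simp⟩
  rwa [LinearMap.coe_range] at this

/-- A bounded operator is determined by its action on coherent vectors. -/
theorem ext_coherent {S T : FockSpace μ →L[ℂ] FockSpace μ}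
    (h : ∀ g : Lp ℂ 2 μ, S (coherent g) = T (coherent g)) : S = T := by
  refine ContinuousLinearMap.coeFn_injective
    (denseRange_coherent.equalizer S.continuous T.continuous (funext fun v => ?_))
  simp only [Function.comp_apply, Finsupp.linearCombination_apply, Finsupp.sum, map_sum, map_smul,
    h]

variable (μ) in
/-- The Fock vacuum: the coherent vector `e^0`, equal to `1` in the `0`-particle component and to
`0` in all others. -/
def vacuum : FockSpace μ := coherent 0

/-- The action of the Weyl operator `W(f)` on coherent vectors,
`W(f) e^g = exp (-‖f‖² / 2 + i ⟨f, g⟩) e^{g + i f}`. -/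
def weylAux (f g : Lp ℂ 2 μ) : FockSpace μ :=
  Complex.exp (-(‖f‖ : ℂ) ^ 2 / 2 + Complex.I * inner ℂ f g) • coherent (g + Complex.I • f)

/-- The Weyl operator `W(f)` on the Fock space: the unique bounded operator such that
`W(f) e^g = exp (-‖f‖² / 2 + i ⟨f, g⟩) e^{g + i f}` for all `g`. It is the unitary
`exp (i (a(f) + a(f)^*))`. -/
def weyl (f : Lp ℂ 2 μ) : FockSpace μ →L[ℂ] FockSpace μ :=
  (Finsupp.linearCombination ℂ (weylAux f)).extendOfNorm
    (Finsupp.linearCombination ℂ (coherent : Lp ℂ 2 μ → FockSpace μ))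

theorem inner_weylAux (f g h : Lp ℂ 2 μ) :
    inner ℂ (weylAux f g) (weylAux f h) = inner ℂ (coherent g) (coherent h) := by
  rw [weylAux, weylAux, inner_smul_left, inner_smul_right, inner_coherent, inner_coherent,
    ← Complex.exp_conj, ← Complex.exp_add, ← Complex.exp_add]
  congr 1
  simp only [map_add, map_mul, map_div₀, map_neg, map_pow, Complex.conj_ofReal, Complex.conj_I,
    inner_conj_symm, inner_add_left, inner_add_right, inner_smul_left, inner_smul_right,
    inner_self_eq_norm_sq_to_K, map_ofNat]
  simp only [Complex.coe_algebraMap]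
  linear_combination (-(‖f‖ : ℂ) ^ 2) * Complex.I_sq

theorem norm_weylAux (f : Lp ℂ 2 μ) (v : Lp ℂ 2 μ →₀ ℂ) :
    ‖Finsupp.linearCombination ℂ (weylAux f) v‖ =
      ‖Finsupp.linearCombination ℂ (coherent : Lp ℂ 2 μ → FockSpace μ) v‖ := by
  have : inner ℂ (Finsupp.linearCombination ℂ (weylAux f) v)
        (Finsupp.linearCombination ℂ (weylAux f) v) =
      inner ℂ (Finsupp.linearCombination ℂ (coherent : Lp ℂ 2 μ → FockSpace μ) v)
        (Finsupp.linearCombination ℂ (coherent : Lp ℂ 2 μ → FockSpace μ) v) := by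
    simp only [Finsupp.linearCombination_apply, Finsupp.sum, sum_inner, inner_sum,
      inner_smul_left, inner_smul_right, inner_weylAux]
  rw [inner_self_eq_norm_sq_to_K, inner_self_eq_norm_sq_to_K] at this
  exact (pow_left_inj₀ (norm_nonneg _) (norm_nonneg _) two_ne_zero).1 (by exact_mod_cast this)

theorem weyl_coherent (f g : Lp ℂ 2 μ) :
    weyl f (coherent g) =
      Complex.exp (-(‖f‖ : ℂ) ^ 2 / 2 + Complex.I * inner ℂ f g) •
        coherent (g + Complex.I • f) := by
  have := LinearMap.extendOfNorm_eq (f := Finsupp.linearCombination ℂ (weylAux f))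
    denseRange_coherent ⟨1, fun v => by rw [one_mul, norm_weylAux]⟩ (Finsupp.single g 1)
  simpa [weyl, weylAux] using this

/-- The Weyl relations. -/
theorem weyl_mul (f g : Lp ℂ 2 μ) :
    weyl f * weyl g = Complex.exp (-Complex.I * (inner ℂ f g : ℂ).im) • weyl (f + g) := by
  refine ext_coherent fun h => ?_
  rw [mul_apply_eq_comp, weyl_coherent, map_smul, weyl_coherent, smul_smul,
    smul_apply, weyl_coherent, smul_smul, ← Complex.exp_add,
    ← Complex.exp_add]
  have hn : ((‖f + g‖ : ℝ) : ℂ) ^ 2 = (‖f‖ : ℂ) ^ 2 + 2 * ((inner ℂ f g : ℂ).re : ℂ)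
      + (‖g‖ : ℂ) ^ 2 := by
    have := norm_add_sq (𝕜 := ℂ) f g
    exact_mod_cast this
  have hi : (inner ℂ f g : ℂ) = (inner ℂ f g : ℂ).re + (inner ℂ f g : ℂ).im * Complex.I :=
    (Complex.re_add_im _).symm
  congr 2
  · rw [hn]
    simp only [inner_add_left, inner_add_right, inner_smul_right]
    linear_combination Complex.I * Complex.I * hi + (((inner ℂ f g : ℂ).re : ℂ)
      + (inner ℂ f g : ℂ).im * Complex.I) * Complex.I_sq
  · rw [smul_add]; abel

theorem norm_weyl_apply (f : Lp ℂ 2 μ) (Ψ : FockSpace μ) : ‖weyl f Ψ‖ = ‖Ψ‖ := by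
  refine denseRange_coherent.induction_on (p := fun Ψ => ‖weyl f Ψ‖ = ‖Ψ‖) Ψ
    (isClosed_eq (weyl f).continuous.norm continuous_norm) fun v => ?_
  rw [← norm_weylAux f v]
  exact congrArg _ (LinearMap.extendOfNorm_eq (f := Finsupp.linearCombination ℂ (weylAux f))
    denseRange_coherent ⟨1, fun v => by rw [one_mul, norm_weylAux]⟩ v)

theorem weyl_zero : weyl (0 : Lp ℂ 2 μ) = 1 :=
  ext_coherent fun g => by rw [weyl_coherent]; simp

theorem weyl_mul_weyl_neg (f : Lp ℂ 2 μ) : weyl f * weyl (-f) = 1 := by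
  rw [weyl_mul, inner_neg_right, inner_self_eq_norm_sq_to_K, add_neg_cancel, weyl_zero]
  simp [← Complex.ofReal_pow]

theorem star_weyl (f : Lp ℂ 2 μ) : star (weyl f) = weyl (-f) := by
  have h : star (weyl f) * weyl f = 1 :=
    (ContinuousLinearMap.norm_map_iff_adjoint_comp_self _).1 (norm_weyl_apply f)
  calc star (weyl f) = star (weyl f) * (weyl f * weyl (-f)) := by
        rw [weyl_mul_weyl_neg, mul_one]
    _ = weyl (-f) := by rw [← mul_assoc, h, one_mul]

/-- The von Neumann algebra `{W(f) | f ∈ K}''` (double commutant). -/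
def weylAlgebra (K : Set (Lp ℂ 2 μ)) : VonNeumannAlgebra (FockSpace μ) where
  carrier := Set.centralizer (Set.centralizer (weyl '' K))
  mul_mem' := Set.mul_mem_centralizer
  add_mem' := Set.add_mem_centralizer
  algebraMap_mem' := fun c => (Subalgebra.centralizer ℂ (Set.centralizer (weyl '' K))).algebraMap_mem c
  star_mem' := by
    refine Set.star_mem_centralizer' fun T hT => ?_
    rintro _ ⟨f, hf, rfl⟩
    have h1 : weyl f * T = T * weyl f := hT _ ⟨f, hf, rfl⟩
    have h2 : weyl (-f) * weyl f = 1 := by simpa using weyl_mul_weyl_neg (-f)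
    have h3 : weyl (-f) * T = T * weyl (-f) := by
      calc weyl (-f) * T = weyl (-f) * T * (weyl f * weyl (-f)) := by
            rw [weyl_mul_weyl_neg, mul_one]
        _ = weyl (-f) * (T * weyl f) * weyl (-f) := by simp only [mul_assoc]
        _ = weyl (-f) * weyl f * T * weyl (-f) := by rw [← h1]; simp only [mul_assoc]
        _ = T * weyl (-f) := by rw [h2, one_mul]
    have h4 : star T * star (weyl (-f)) = star (weyl (-f)) * star T :=
      (star_mul (weyl (-f)) T).symm.trans ((congrArg star h3).trans (star_mul T (weyl (-f))))
    rw [star_weyl, neg_neg] at h4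
    exact h4.symm
  centralizer_centralizer' := Set.centralizer_centralizer_centralizer _

end Fock

/-- `Ω` is cyclic for `M` if `M Ω` is dense. -/
def IsCyclicVector {H : Type*} [NormedAddCommGroup H] [InnerProductSpace ℂ H] [CompleteSpace H]
    (M : VonNeumannAlgebra H) (Ω : H) : Prop :=
  Dense {Ψ : H | ∃ a ∈ M, a Ω = Ψ}

/-- `Ω` is separating for `M` if no non-zero element of `M` annihilates `Ω`. -/
def IsSeparatingVector {H : Type*} [NormedAddCommGroup H] [InnerProductSpace ℂ H]
    [CompleteSpace H] (M : VonNeumannAlgebra H) (Ω : H) : Prop :=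
  ∀ a ∈ M, a Ω = 0 → a = 0

section OneParticle

/-- The plane `ℝ²`. Minkowski space `ℝ⁴` is written as `Plane × Plane`, a point being
`x = (x_q, x_c)` with quantum coordinates `x_q = (x⁰, x¹)` and classical coordinates
`x_c = (x², x³)`. -/
abbrev Plane : Type := EuclideanSpace ℝ (Fin 2)

/-- The space of spatial momenta `ℝ³`, which parametrizes the massless shell by
`p ↦ (‖p‖, p)`. -/
abbrev Momentum : Type := EuclideanSpace ℝ (Fin 3)

/-- The Lorentz invariant measure `d³p / (2 ‖p‖)` on the massless shell. -/
def shellMeasure : Measure Momentum :=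
  volume.withDensity fun p => ENNReal.ofReal (1 / (2 * ‖p‖))

instance sigmaFinite_shellMeasure : SigmaFinite shellMeasure :=
  SigmaFinite.withDensity_ofReal _

/-- The one-particle Hilbert space of the massless scalar field. -/
abbrev OneParticle : Type := Lp ℂ 2 shellMeasure

/-- The Minkowski product `k^μ x_μ` (signature `+ - - -`) of the lightlike vector
`k = (‖p‖, p)` with `x`. -/
def minkowski (p : Momentum) (x : Plane × Plane) : ℝ :=
  ‖p‖ * x.1 0 - p 0 * x.1 1 - p 1 * x.2 0 - p 2 * x.2 1

/-- The function `(E f)(p) = √(2π) f̂(‖p‖, p)` on the massless shell, with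
`f̂(k) = (2π)⁻² ∫ f(x) exp (-i k^μ x_μ) d⁴x`. -/
def shellTransform (f : Plane × Plane → ℝ) (p : Momentum) : ℂ :=
  Real.sqrt (2 * Real.pi) * ((((2 * Real.pi) ^ 2)⁻¹ : ℝ) *
    ∫ x : Plane × Plane, Complex.exp (-Complex.I * minkowski p x) * f x)

/-- The standard degenerate symplectic form on `ℝ⁴`. -/
def sigmaStd : Matrix (Fin 4) (Fin 4) ℝ :=
  !![0, -1, 0, 0; 1, 0, 0, 0; 0, 0, 0, 0; 0, 0, 0, 0]

/-- The norm of a skew-symmetric form, `‖σ‖² = Tr(σᵀ σ) / 4`. -/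
def skewNorm (σ : Matrix (Fin 4) (Fin 4) ℝ) : ℝ := Real.sqrt ((σ.transpose * σ).trace / 4)

/-- The data `(f, ξ)` of a localized state `ω_{f,ξ}`: a centre `ξ ∈ ℝ²` and a non-negative test
function `f ∈ 𝒟(ℝ²)`, normalized since `∫ f` is the value of `ω_{f,ξ}` at the identity. -/
structure LocState where
  center : Plane
  profile : Plane → ℝ
  contDiff : ContDiff ℝ (⊤ : ℕ∞) profile
  compact : HasCompactSupport profile
  nonneg : ∀ y, 0 ≤ profile y
  integral_eq_one : ∫ y, profile y = 1

/-- The function `ψ_ω(x) = f(x_c) (2π‖σ‖)⁻¹ exp (-‖x_q - ξ‖² / (2‖σ‖))` on Minkowski space that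
belongs to the state `ω = ω_{f,ξ}`, where `σ` is the standard form. -/
def LocState.psi (ω : LocState) (x : Plane × Plane) : ℝ :=
  ω.profile x.2 * ((2 * Real.pi * skewNorm sigmaStd)⁻¹ *
    Real.exp (-‖x.1 - ω.center‖ ^ 2 / (2 * skewNorm sigmaStd)))

/-- The support `{ξ} × supp f ⊆ ℝ⁴` of `ψ_ω` in the sense used for localization. -/
def LocState.supp (ω : LocState) : Set (Plane × Plane) := {ω.center} ×ˢ tsupport ω.profile

theorem skewNorm_sigmaStd_pos : 0 < skewNorm sigmaStd := by
  refine Real.sqrt_pos.2 ?_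
  simp [Matrix.trace, Matrix.mul_apply, sigmaStd, Fin.sum_univ_four]

theorem gaussian_integral_aux (ξ w : Plane) {s : ℝ} (hs : 0 < s) :
    ‖∫ y : Plane, Complex.exp (-Complex.I * (inner ℝ w y : ℝ)) *
      (((2 * Real.pi * s)⁻¹ * Real.exp (-‖y - ξ‖ ^ 2 / (2 * s)) : ℝ) : ℂ)‖
      = Real.exp (-s * ‖w‖ ^ 2 / 2) := by
  have hb : 0 < ((1 / (2 * s) : ℝ) : ℂ).re := by rw [Complex.ofReal_re]; positivity
  have hg := GaussianFourier.integral_cexp_neg_mul_sq_norm_add hb (-Complex.I) w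
  have h1 : ∀ y : Plane, Complex.exp (-Complex.I * (inner ℝ w (y + ξ) : ℝ)) *
      (((2 * Real.pi * s)⁻¹ * Real.exp (-‖y + ξ - ξ‖ ^ 2 / (2 * s)) : ℝ) : ℂ) =
      (Complex.exp (-Complex.I * (inner ℝ w ξ : ℝ)) * ((2 * Real.pi * s)⁻¹ : ℝ)) *
      Complex.exp (-((1 / (2 * s) : ℝ) : ℂ) * ‖y‖ ^ 2 + -Complex.I * (inner ℝ w y : ℝ)) := by
    intro y
    rw [add_sub_cancel_right, inner_add_right, Complex.ofReal_mul, Complex.ofReal_exp]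
    rw [mul_left_comm, ← Complex.exp_add, mul_right_comm (Complex.exp _), ← Complex.exp_add,
      mul_comm]
    congr 2
    push_cast
    ring
  rw [← integral_add_right_eq_self _ ξ]
  simp_rw [h1]
  rw [integral_const_mul, hg, norm_mul, norm_mul, norm_mul]
  have e1 : ‖Complex.exp (-Complex.I * (inner ℝ w ξ : ℝ))‖ = 1 := by
    rw [Complex.norm_exp]; simp
  have e2 : ‖((Real.pi : ℂ) / ((1 / (2 * s) : ℝ) : ℂ)) ^ ((Module.finrank ℝ Plane : ℂ) / 2)‖
      = 2 * Real.pi * s := by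
    have : ((Module.finrank ℝ Plane : ℂ) / 2) = 1 := by simp
    rw [this, Complex.cpow_one, ← Complex.ofReal_div, Complex.norm_real, Real.norm_eq_abs,
      abs_of_pos (by positivity)]
    field_simp
  have e3 : (-Complex.I) ^ 2 * (‖w‖ : ℂ) ^ 2 / (4 * ((1 / (2 * s) : ℝ) : ℂ))
      = ((-s * ‖w‖ ^ 2 / 2 : ℝ) : ℂ) := by
    have : (s : ℂ) ≠ 0 := by exact_mod_cast hs.ne'
    rw [neg_sq, Complex.I_sq]
    push_cast
    field_simp
    ring
  rw [e1, e2, e3, ← Complex.ofReal_exp, Complex.norm_real, Complex.norm_real, Real.norm_eq_abs,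
    Real.norm_eq_abs, abs_of_pos (by positivity), abs_of_pos (Real.exp_pos _)]
  have : 2 * Real.pi * s ≠ 0 := by positivity
  field_simp

theorem integrable_shell_gaussian {s : ℝ} (hs : 0 < s) :
    Integrable (fun p : Momentum => Real.exp (-s * ‖p‖ ^ 2)) shellMeasure := by
  rw [shellMeasure, integrable_withDensity_iff (by fun_prop)
    (Filter.Eventually.of_forall fun _ => ENNReal.ofReal_lt_top)]
  have : Integrable (fun p : Momentum => (fun r : ℝ => Real.exp (-s * r ^ 2) *
      (ENNReal.ofReal (1 / (2 * r))).toReal) ‖p‖) := by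
    refine (integrable_fun_norm_addHaar (volume : Measure Momentum)
      (f := fun r : ℝ => Real.exp (-s * r ^ 2) * (ENNReal.ofReal (1 / (2 * r))).toReal)).2 ?_
    have h := (integrableOn_rpow_mul_exp_neg_mul_sq hs (s := 1) (by norm_num)).const_mul (1 / 2)
    refine IntegrableOn.congr_fun h (fun r hr => ?_) measurableSet_Ioi
    have hr' : (0 : ℝ) < r := hr
    simp only [finrank_euclideanSpace, Fintype.card_fin, smul_eq_mul, Real.rpow_one]
    rw [ENNReal.toReal_ofReal (by positivity)]
    field_simp
  exact this

theorem norm_shellTransform_psi_le (ω : LocState) : ∃ C : ℝ, ∀ p : Momentum,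
    ‖shellTransform ω.psi p‖ ≤ C * Real.exp (-skewNorm sigmaStd * ‖p‖ ^ 2 / 2) := by
  have hs := skewNorm_sigmaStd_pos
  set s := skewNorm sigmaStd with hsdef
  refine ⟨‖(Real.sqrt (2 * Real.pi) : ℂ)‖ * (‖((((2 * Real.pi) ^ 2)⁻¹ : ℝ) : ℂ)‖ *
    ∫ y, ‖ω.profile y‖), fun p => ?_⟩
  let w : Plane := !₂[‖p‖, -p 0]
  let u : Plane := !₂[-p 1, -p 2]
  have hsplit : ∀ x : Plane × Plane,
      Complex.exp (-Complex.I * minkowski p x) * (ω.psi x : ℂ) =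
      (Complex.exp (-Complex.I * (inner ℝ w x.1 : ℝ)) *
        (((2 * Real.pi * s)⁻¹ * Real.exp (-‖x.1 - ω.center‖ ^ 2 / (2 * s)) : ℝ) : ℂ)) *
      (Complex.exp (-Complex.I * (inner ℝ u x.2 : ℝ)) * (ω.profile x.2 : ℂ)) := by
    intro x
    have hm : minkowski p x = inner ℝ w x.1 + inner ℝ u x.2 := by
      simp [minkowski, w, u, PiLp.inner_apply, Fin.sum_univ_two]
      ring
    rw [hm, LocState.psi, ← hsdef, Complex.ofReal_add, mul_add, Complex.exp_add]
    push_cast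
    ring
  rw [shellTransform]
  simp_rw [hsplit]
  rw [Measure.volume_eq_prod,
    integral_prod_mul (f := fun y : Plane => Complex.exp (-Complex.I * (inner ℝ w y : ℝ)) *
      (((2 * Real.pi * s)⁻¹ * Real.exp (-‖y - ω.center‖ ^ 2 / (2 * s)) : ℝ) : ℂ))
    (g := fun y : Plane => Complex.exp (-Complex.I * (inner ℝ u y : ℝ)) * (ω.profile y : ℂ)),
    norm_mul, norm_mul, norm_mul, gaussian_integral_aux ω.center w hs]
  have h2 : ‖∫ y : Plane, Complex.exp (-Complex.I * (inner ℝ u y : ℝ)) * (ω.profile y : ℂ)‖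
      ≤ ∫ y, ‖ω.profile y‖ := by
    refine (norm_integral_le_integral_norm _).trans (le_of_eq ?_)
    refine integral_congr_ae (Filter.Eventually.of_forall fun y => ?_)
    have : ‖Complex.exp (-Complex.I * (inner ℝ u y : ℝ))‖ = 1 := by
      rw [Complex.norm_exp]; simp
    simp only [norm_mul, this, one_mul, Complex.norm_real]
  have h1 : Real.exp (-s * ‖w‖ ^ 2 / 2) ≤ Real.exp (-s * ‖p‖ ^ 2 / 2) := by
    refine Real.exp_le_exp.2 ?_
    have : ‖w‖ ^ 2 = ‖p‖ ^ 2 + (p 0) ^ 2 := by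
      rw [EuclideanSpace.norm_sq_eq]
      simp [w, Fin.sum_univ_two]
    rw [this]
    nlinarith [mul_nonneg hs.le (sq_nonneg (p 0))]
  calc _ ≤ ‖(Real.sqrt (2 * Real.pi) : ℂ)‖ * (‖((((2 * Real.pi) ^ 2)⁻¹ : ℝ) : ℂ)‖ *
        (Real.exp (-s * ‖p‖ ^ 2 / 2) * ∫ y, ‖ω.profile y‖)) := by gcongr
    _ = _ := by ring

theorem stronglyMeasurable_shellTransform_psi (ω : LocState) :
    StronglyMeasurable (shellTransform ω.psi) := by
  have hprof := ω.contDiff.continuous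
  have hc : Continuous fun z : Momentum × (Plane × Plane) =>
      Complex.exp (-Complex.I * minkowski z.1 z.2) * (ω.psi z.2 : ℂ) := by
    unfold minkowski LocState.psi
    fun_prop
  have h := hc.stronglyMeasurable.integral_prod_right' (ν := (volume : Measure (Plane × Plane)))
  exact (h.const_mul _).const_mul _

theorem memLp_shellTransform_psi (ω : LocState) :
    MemLp (shellTransform ω.psi) 2 shellMeasure := by
  have hm := (stronglyMeasurable_shellTransform_psi ω).aestronglyMeasurable (μ := shellMeasure)
  rw [memLp_two_iff_integrable_sq_norm hm]
  obtain ⟨C, hC⟩ := norm_shellTransform_psi_le ω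
  refine ((integrable_shell_gaussian skewNorm_sigmaStd_pos).const_mul (C ^ 2)).mono'
    (hm.norm.pow 2) (Filter.Eventually.of_forall fun p => ?_)
  rw [Real.norm_eq_abs, abs_of_nonneg (by positivity)]
  refine (pow_le_pow_left₀ (norm_nonneg _) (hC p) 2).trans (le_of_eq ?_)
  rw [mul_pow, ← Real.exp_nat_mul]
  congr 2
  push_cast
  ring

/-- The one-particle vector `E ψ_ω`. -/
def LocState.vector (ω : LocState) : OneParticle := (memLp_shellTransform_psi ω).toLp _

/-- The vectors `E ψ_ω` of the states `ω` localized in `S ⊆ ℝ⁴`. For `S = {x_q} × D` these are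
the states `ω_{f,ξ}` with `ξ = x_q` and `supp f ⊆ D`. -/
def localVectors (S : Set (Plane × Plane)) : Set OneParticle :=
  {h | ∃ ω : LocState, ω.supp ⊆ S ∧ ω.vector = h}

/-- The field algebra of `S`: the von Neumann algebra generated by the Weyl operators
`W(ω) = W(E ψ_ω)` of the states `ω` localized in `S`. -/
def fieldAlgebra (S : Set (Plane × Plane)) : VonNeumannAlgebra (FockSpace shellMeasure) :=
  weylAlgebra (localVectors S)

end OneParticle

section Regions

/-- The electric part of a skew-symmetric `4 × 4` matrix. -/
def electric (σ : Matrix (Fin 4) (Fin 4) ℝ) : Fin 3 → ℝ := ![σ 0 1, σ 0 2, σ 0 3]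

/-- The magnetic part of a skew-symmetric `4 × 4` matrix. -/
def magnetic (σ : Matrix (Fin 4) (Fin 4) ℝ) : Fin 3 → ℝ := ![σ 2 3, σ 3 1, σ 1 2]

/-- The joint spectrum `Σ₀` of the commutators of the coordinates: non-zero skew-symmetric forms
whose electric and magnetic parts are orthogonal and of equal norm. -/
def jointSpectrum : Set (Matrix (Fin 4) (Fin 4) ℝ) :=
  {σ | σ.transpose = -σ ∧ σ ≠ 0 ∧ electric σ ⬝ᵥ electric σ = magnetic σ ⬝ᵥ magnetic σ ∧
    electric σ ⬝ᵥ magnetic σ = 0}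

/-- The index set of the net: triples `(σ, x_q, D)` with `σ ∈ Σ₀`, `x_q ∈ ℝ²`, and `D ⊆ ℝ²`
bounded. -/
structure Region where
  form : Matrix (Fin 4) (Fin 4) ℝ
  form_mem : form ∈ jointSpectrum
  point : Plane
  base : Set Plane
  bounded : Bornology.IsBounded base

/-- The projection `π (σ, x_q, D) = {x_q} × D`. -/
def Region.proj (R : Region) : Set (Plane × Plane) := {R.point} ×ˢ R.base

end Regions

end ScaleCov

end

noncomputable section

namespace ScaleCov

section Fock

variable {X : Type*} [MeasurableSpace X] {μ : Measure X} [SigmaFinite μ]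

theorem norm_coherent (f : Lp ℂ 2 μ) : ‖coherent f‖ = Real.sqrt (Real.exp (‖f‖ ^ 2)) := by
  have h : ((‖coherent f‖ : ℝ) : ℂ) ^ 2 = Complex.exp ((‖f‖ : ℂ) ^ 2) :=
    (inner_self_eq_norm_sq_to_K (𝕜 := ℂ) (coherent f)).symm.trans <|
      (inner_coherent f f).trans (congrArg _ (inner_self_eq_norm_sq_to_K (𝕜 := ℂ) f))
  rw [eq_comm, Real.sqrt_eq_iff_eq_sq (Real.exp_pos _).le (norm_nonneg _)]
  rw [← Complex.ofReal_pow, ← Complex.ofReal_pow, ← Complex.ofReal_exp] at h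
  exact (Complex.ofReal_injective h).symm

/-- Matrix elements of coherent vectors along a complex line are entire functions. -/
theorem differentiable_inner_coherent (Φ : FockSpace μ) (x y : Lp ℂ 2 μ) :
    Differentiable ℂ fun z : ℂ => (inner ℂ Φ (coherent (x + z • y)) : ℂ) := by
  obtain ⟨s, hs, hlim⟩ := mem_closure_iff_seq_limit.1 (denseRange_coherent (μ := μ) Φ)
  rw [← differentiableOn_univ]
  refine TendstoLocallyUniformlyOn.differentiableOn (φ := Filter.atTop)
    (F := fun (j : ℕ) (z : ℂ) => (inner ℂ (s j) (coherent (x + z • y)) : ℂ)) ?_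
    (Filter.Eventually.of_forall fun j => ?_) isOpen_univ
  · rw [tendstoLocallyUniformlyOn_iff_forall_isCompact isOpen_univ]
    intro T _ hT
    obtain ⟨C, hC⟩ := hT.exists_bound_of_continuousOn
      (f := fun z : ℂ => Real.sqrt (Real.exp (‖x + z • y‖ ^ 2))) (by fun_prop)
    rw [Metric.tendstoUniformlyOn_iff]
    intro ε hε
    have h0 : Filter.Tendsto (fun j => ‖Φ - s j‖ * C) Filter.atTop (nhds 0) := by
      have := ((tendsto_const_nhds (x := Φ)).sub hlim).norm.mul_const C
      simpa using this
    filter_upwards [h0.eventually_lt_const hε] with j hj z hz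
    rw [dist_eq_norm, ← inner_sub_left]
    refine (norm_inner_le_norm _ _).trans_lt (lt_of_le_of_lt ?_ hj)
    refine mul_le_mul_of_nonneg_left ?_ (norm_nonneg _)
    rw [norm_coherent]
    exact (le_abs_self _).trans (hC z hz)
  · obtain ⟨v, hv⟩ := hs j
    rw [← hv]
    simp only [Finsupp.linearCombination_apply, Finsupp.sum, sum_inner, inner_smul_left,
      inner_coherent, inner_add_right, inner_smul_right]
    fun_prop

theorem commute_weyl {f g : Lp ℂ 2 μ} (h : (inner ℂ f g : ℂ).im = 0) :
    weyl f * weyl g = weyl g * weyl f := by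
  have h' : (inner ℂ g f : ℂ).im = 0 := by
    rw [← inner_conj_symm, Complex.conj_im, h, neg_zero]
  rw [weyl_mul, weyl_mul, h, h', add_comm]

theorem weyl_vacuum (f : Lp ℂ 2 μ) :
    weyl f (vacuum μ) = Complex.exp (-(‖f‖ : ℂ) ^ 2 / 2) • coherent (Complex.I • f) := by
  rw [vacuum, weyl_coherent]
  simp

/-- The vacuum separates a Weyl algebra whose test vectors are real with respect to a
conjugation `J` of the one-particle space. -/
theorem isSeparatingVector_vacuum_of_conjugation {K : Set (Lp ℂ 2 μ)} (J : Lp ℂ 2 μ → Lp ℂ 2 μ)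
    (hadd : ∀ f g, J (f + g) = J f + J g)
    (hsmul : ∀ (c : ℂ) f, J (c • f) = starRingEnd ℂ c • J f)
    (hinv : ∀ f, J (J f) = f) (hinner : ∀ f g, (inner ℂ (J f) g : ℂ) = inner ℂ (J g) f)
    (hK : ∀ f ∈ K, J f = f) :
    IsSeparatingVector (weylAlgebra K) (vacuum μ) := by
  intro a ha haΩ
  have hreal : ∀ k, J k = k → a (coherent (Complex.I • k)) = 0 := by
    intro k hk
    have hc : weyl k ∈ Set.centralizer (weyl '' K) := by
      rintro _ ⟨f, hf, rfl⟩
      refine commute_weyl (Complex.conj_eq_iff_im.1 ?_)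
      have := hinner f k
      rw [hK f hf, hk] at this
      rw [inner_conj_symm, this]
    have hcomm : weyl k * a = a * weyl k := ha _ hc
    have h1 := congrArg (fun T : FockSpace μ →L[ℂ] FockSpace μ => T (vacuum μ)) hcomm
    simp only [mul_apply_eq_comp, haΩ, map_zero, weyl_vacuum, map_smul] at h1
    exact (smul_eq_zero.1 h1.symm).resolve_left (Complex.exp_ne_zero _)
  refine ext_coherent fun g => ?_
  rw [zero_apply]
  let k : Lp ℂ 2 μ := -Complex.I • g
  let k₁ : Lp ℂ 2 μ := (1 / 2 : ℂ) • (k + J k)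
  let k₂ : Lp ℂ 2 μ := (-Complex.I / 2 : ℂ) • (k + (-1 : ℂ) • J k)
  have hk₁ : J k₁ = k₁ := by
    simp only [k₁, hsmul, hadd, hinv, add_comm (J k)]
    simp only [map_div₀, map_one, map_ofNat]
  have hk₂ : J k₂ = k₂ := by
    simp only [k₂, hsmul, hadd, hinv]
    simp only [map_div₀, map_neg, Complex.conj_I, map_one, map_ofNat]
    module
  have hg : g = Complex.I • k₁ + Complex.I • (Complex.I • k₂) := by
    have hII : Complex.I * Complex.I = -1 := Complex.I_mul_I
    have hk : k = k₁ + Complex.I • k₂ := by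
      simp only [k₁, k₂, smul_smul]
      rw [show Complex.I * (-Complex.I / 2) = 1 / 2 by linear_combination (-1 / 2) * hII]
      module
    rw [← smul_add, ← hk, smul_smul, show Complex.I * -Complex.I = 1 by linear_combination -hII,
      one_smul]
  clear_value k₁ k₂
  refine ext_inner_left ℂ fun Φ => ?_
  rw [inner_zero_right]
  let F : ℂ → ℂ := fun z => inner ℂ (ContinuousLinearMap.adjoint a Φ)
    (coherent (Complex.I • k₁ + z • (Complex.I • k₂)))
  have hF : AnalyticOnNhd ℂ F Set.univ :=
    (differentiable_inner_coherent _ _ _).differentiableOn.analyticOnNhd isOpen_univ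
  have hFreal : ∀ t : ℝ, F t = 0 := by
    intro t
    have ht : J (k₁ + (t : ℂ) • k₂) = k₁ + (t : ℂ) • k₂ := by
      rw [hadd, hsmul, hk₁, hk₂, Complex.conj_ofReal]
    have := hreal _ ht
    simp only [F]
    rw [ContinuousLinearMap.adjoint_inner_left, smul_comm, ← smul_add, this, inner_zero_right]
  have hfreq : ∃ᶠ z in nhdsWithin (0 : ℂ) {0}ᶜ, F z = 0 := by
    have ht : Filter.Tendsto (fun t : ℝ => (t : ℂ)) (nhdsWithin 0 {0}ᶜ)
        (nhdsWithin (0 : ℂ) {0}ᶜ) := by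
      refine tendsto_nhdsWithin_iff.2 ⟨?_, ?_⟩
      · exact (Complex.continuous_ofReal.tendsto' 0 0 (by simp)).mono_left nhdsWithin_le_nhds
      · filter_upwards [self_mem_nhdsWithin] with t ht
        simpa using ht
    exact ht.frequently (Filter.Eventually.of_forall hFreal).frequently
  have hzero := hF.eqOn_zero_of_preconnected_of_frequently_eq_zero isPreconnected_univ
    (Set.mem_univ 0) hfreq (Set.mem_univ Complex.I)
  simp only [F, Pi.zero_apply] at hzero
  rwa [ContinuousLinearMap.adjoint_inner_left, ← hg] at hzero

/-- The second quantization `Γ(U)` of an isometry of the one-particle space, the bounded operator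
with `Γ(U) e^g = e^{U g}`. -/
def secondQuantization (U : Lp ℂ 2 μ →ₗᵢ[ℂ] Lp ℂ 2 μ) : FockSpace μ →L[ℂ] FockSpace μ :=
  (Finsupp.linearCombination ℂ fun g => coherent (U g)).extendOfNorm
    (Finsupp.linearCombination ℂ (coherent : Lp ℂ 2 μ → FockSpace μ))

theorem secondQuantization_coherent (U : Lp ℂ 2 μ →ₗᵢ[ℂ] Lp ℂ 2 μ) (g : Lp ℂ 2 μ) :
    secondQuantization U (coherent g) = coherent (U g) := by
  have hnorm : ∀ v : Lp ℂ 2 μ →₀ ℂ,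
      ‖Finsupp.linearCombination ℂ (fun g => (coherent (U g) : FockSpace μ)) v‖ =
        ‖Finsupp.linearCombination ℂ (coherent : Lp ℂ 2 μ → FockSpace μ) v‖ := by
    intro v
    have : inner ℂ (Finsupp.linearCombination ℂ (fun g => (coherent (U g) : FockSpace μ)) v)
          (Finsupp.linearCombination ℂ (fun g => (coherent (U g) : FockSpace μ)) v) =
        inner ℂ (Finsupp.linearCombination ℂ (coherent : Lp ℂ 2 μ → FockSpace μ) v)
          (Finsupp.linearCombination ℂ (coherent : Lp ℂ 2 μ → FockSpace μ) v) := by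
      simp only [Finsupp.linearCombination_apply, Finsupp.sum, sum_inner, inner_sum,
        inner_smul_left, inner_smul_right, inner_coherent, U.inner_map_map]
    rw [inner_self_eq_norm_sq_to_K, inner_self_eq_norm_sq_to_K] at this
    exact (pow_left_inj₀ (norm_nonneg _) (norm_nonneg _) two_ne_zero).1 (by exact_mod_cast this)
  have := LinearMap.extendOfNorm_eq
    (f := Finsupp.linearCombination ℂ fun g => (coherent (U g) : FockSpace μ))
    denseRange_coherent ⟨1, fun v => by rw [one_mul, hnorm]⟩ (Finsupp.single g 1)
  simpa [secondQuantization] using this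

theorem secondQuantization_mul_weyl (U : Lp ℂ 2 μ →ₗᵢ[ℂ] Lp ℂ 2 μ) (f : Lp ℂ 2 μ) :
    secondQuantization U * weyl f = weyl (U f) * secondQuantization U := by
  refine ext_coherent fun g => ?_
  simp only [mul_apply_eq_comp, weyl_coherent, map_smul, secondQuantization_coherent, map_add,
    U.norm_map, U.inner_map_map]

/-- The vacuum is not cyclic for a Weyl algebra whose test vectors are not total. -/
theorem not_isCyclicVector_vacuum_of_orthogonal {K : Set (Lp ℂ 2 μ)} {v : Lp ℂ 2 μ} (hv : v ≠ 0)
    (hK : ∀ f ∈ K, (inner ℂ v f : ℂ) = 0) :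
    ¬ IsCyclicVector (weylAlgebra K) (vacuum μ) := by
  intro hcyc
  let U : Lp ℂ 2 μ →ₗᵢ[ℂ] Lp ℂ 2 μ := (ℂ ∙ v)ᗮ.reflection.toLinearIsometry
  have hUK : ∀ f ∈ K, U f = f := fun f hf =>
    Submodule.reflection_mem_subspace_eq_self
      (Submodule.mem_orthogonal_singleton_iff_inner_right.2 (hK f hf))
  have hUv : U v = -v := Submodule.reflection_orthogonalComplement_singleton_eq_neg v
  have hΓ : secondQuantization U ∈ Set.centralizer (weyl '' K) := by
    rintro _ ⟨f, hf, rfl⟩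
    rw [secondQuantization_mul_weyl, hUK f hf]
  have hid : secondQuantization U (coherent v) = coherent v := by
    refine hcyc.induction (P := fun Ψ => secondQuantization U Ψ = Ψ) ?_
      (isClosed_eq (secondQuantization U).continuous continuous_id) _
    rintro _ ⟨a, ha, rfl⟩
    have hcomm : secondQuantization U * a = a * secondQuantization U := ha _ hΓ
    have h1 := congrArg (fun T : FockSpace μ →L[ℂ] FockSpace μ => T (vacuum μ)) hcomm
    simpa only [mul_apply_eq_comp, vacuum, secondQuantization_coherent, map_zero] using h1
  rw [secondQuantization_coherent, hUv] at hid
  have h2 : (inner ℂ (coherent v) (coherent (-v)) : ℂ) = inner ℂ (coherent v) (coherent v) :=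
    congrArg _ hid
  have hvv : (inner ℂ v v : ℂ) = ((‖v‖ ^ 2 : ℝ) : ℂ) :=
    (inner_self_eq_norm_sq_to_K (𝕜 := ℂ) v).trans (Complex.ofReal_pow _ _).symm
  rw [inner_coherent, inner_coherent, inner_neg_right, hvv, ← Complex.ofReal_neg,
    ← Complex.ofReal_exp, ← Complex.ofReal_exp] at h2
  have h3 := Complex.ofReal_injective h2
  have h4 : 0 < ‖v‖ ^ 2 := by positivity
  linarith [Real.exp_injective h3]

end Fock

section OneParticle

theorem measurePreserving_shell (L : Momentum ≃ₗᵢ[ℝ] Momentum) :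
    MeasurePreserving L shellMeasure shellMeasure := by
  refine ⟨L.continuous.measurable, Measure.ext fun s hs => ?_⟩
  rw [Measure.map_apply L.continuous.measurable hs, shellMeasure,
    withDensity_apply _ (L.continuous.measurable hs), withDensity_apply _ hs,
    ← L.measurePreserving.setLIntegral_comp_preimage hs (by fun_prop)]
  simp only [L.norm_map]

theorem integral_shell_comp (L : Momentum ≃ₗᵢ[ℝ] Momentum) (F : Momentum → ℂ) :
    ∫ p, F (L p) ∂shellMeasure = ∫ p, F p ∂shellMeasure :=
  (measurePreserving_shell L).integral_comp L.toHomeomorph.measurableEmbedding F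

/-- The reflection of the momentum along the quantum axis, `p ↦ (-p₁, p₂, p₃)`. -/
def axisReflection : Momentum ≃ₗᵢ[ℝ] Momentum :=
  LinearIsometryEquiv.piLpCongrRight 2 fun i : Fin 3 =>
    if i = 0 then LinearIsometryEquiv.neg ℝ else LinearIsometryEquiv.refl ℝ ℝ

theorem axisReflection_zero (p : Momentum) : axisReflection p 0 = -p 0 := by
  simp [axisReflection]

theorem axisReflection_one (p : Momentum) : axisReflection p 1 = p 1 := by
  simp [axisReflection]

theorem axisReflection_two (p : Momentum) : axisReflection p 2 = p 2 := by
  simp [axisReflection]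

theorem axisReflection_axisReflection (p : Momentum) :
    axisReflection (axisReflection p) = p := by
  ext i
  fin_cases i
  · simp [axisReflection_zero]
  · simp [axisReflection_one]
  · simp [axisReflection_two]

/-- The reflection of the classical components of the momentum, `p ↦ (p₁, -p₂, -p₃)`. -/
def transverseReflection : Momentum ≃ₗᵢ[ℝ] Momentum :=
  axisReflection.trans (LinearIsometryEquiv.neg ℝ)

theorem transverseReflection_apply (p : Momentum) :
    transverseReflection p = -axisReflection p := rfl

theorem transverseReflection_transverseReflection (p : Momentum) :
    transverseReflection (transverseReflection p) = p := by
  rw [transverseReflection_apply, transverseReflection_apply, map_neg,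
    axisReflection_axisReflection, neg_neg]

/-- The plane wave on the mass shell belonging to the quantum point `ξ`. -/
def shellPhase (ξ : Plane) (p : Momentum) : ℂ :=
  Complex.exp (-Complex.I * minkowski p (ξ, 0))

theorem continuous_shellPhase (ξ : Plane) : Continuous (shellPhase ξ) := by
  unfold shellPhase minkowski
  fun_prop

theorem conj_shellPhase_mul_self (ξ : Plane) (p : Momentum) :
    starRingEnd ℂ (shellPhase ξ p) * shellPhase ξ p = 1 := by
  rw [shellPhase, ← Complex.exp_conj, ← Complex.exp_add]
  simp

theorem norm_shellPhase (ξ : Plane) (p : Momentum) : ‖shellPhase ξ p‖ = 1 := by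
  rw [shellPhase, Complex.norm_exp]
  simp

theorem shellPhase_transverseReflection (ξ : Plane) (p : Momentum) :
    shellPhase ξ (transverseReflection p) = shellPhase ξ p := by
  simp [shellPhase, minkowski, transverseReflection_apply, axisReflection_zero]

theorem gaussian_integral_eq (ξ w : Plane) {s : ℝ} (hs : 0 < s) :
    ∫ y : Plane, Complex.exp (-Complex.I * (inner ℝ w y : ℝ)) *
      (((2 * Real.pi * s)⁻¹ * Real.exp (-‖y - ξ‖ ^ 2 / (2 * s)) : ℝ) : ℂ)
      = Complex.exp (-Complex.I * (inner ℝ w ξ : ℝ)) * (Real.exp (-s * ‖w‖ ^ 2 / 2) : ℝ) := by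
  have hb : 0 < ((1 / (2 * s) : ℝ) : ℂ).re := by rw [Complex.ofReal_re]; positivity
  have hg := GaussianFourier.integral_cexp_neg_mul_sq_norm_add hb (-Complex.I) w
  have h1 : ∀ y : Plane, Complex.exp (-Complex.I * (inner ℝ w (y + ξ) : ℝ)) *
      (((2 * Real.pi * s)⁻¹ * Real.exp (-‖y + ξ - ξ‖ ^ 2 / (2 * s)) : ℝ) : ℂ) =
      (Complex.exp (-Complex.I * (inner ℝ w ξ : ℝ)) * ((2 * Real.pi * s)⁻¹ : ℝ)) *
      Complex.exp (-((1 / (2 * s) : ℝ) : ℂ) * ‖y‖ ^ 2 + -Complex.I * (inner ℝ w y : ℝ)) := by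
    intro y
    rw [add_sub_cancel_right, inner_add_right, Complex.ofReal_mul, Complex.ofReal_exp]
    rw [mul_left_comm, ← Complex.exp_add, mul_right_comm (Complex.exp _), ← Complex.exp_add,
      mul_comm]
    congr 2
    push_cast
    ring
  have e2 : ((Module.finrank ℝ Plane : ℂ) / 2) = 1 := by simp
  have hs' : (s : ℂ) ≠ 0 := by exact_mod_cast hs.ne'
  have hpi : (Real.pi : ℂ) ≠ 0 := by exact_mod_cast Real.pi_ne_zero
  have e3 : (-Complex.I) ^ 2 * (‖w‖ : ℂ) ^ 2 / (4 * ((1 / (2 * s) : ℝ) : ℂ))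
      = ((-s * ‖w‖ ^ 2 / 2 : ℝ) : ℂ) := by
    rw [neg_sq, Complex.I_sq]
    push_cast
    field_simp
    ring
  rw [← integral_add_right_eq_self _ ξ]
  simp_rw [h1]
  rw [integral_const_mul, hg, e2, Complex.cpow_one, e3, ← Complex.ofReal_exp]
  push_cast
  field_simp

/-- The factor of `E ψ_ω` that is left when the plane wave of the centre is split off. -/
def LocState.amplitude (ω : LocState) (p : Momentum) : ℂ :=
  (Real.sqrt (2 * Real.pi) * ((2 * Real.pi) ^ 2)⁻¹ *
      Real.exp (-skewNorm sigmaStd * (‖p‖ ^ 2 + p 0 ^ 2) / 2) : ℝ) *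
    ∫ y : Plane, Complex.exp (Complex.I * (p 1 * y 0 + p 2 * y 1 : ℝ)) * (ω.profile y : ℂ)

theorem shellTransform_psi_eq (ω : LocState) (p : Momentum) :
    shellTransform ω.psi p = shellPhase ω.center p * ω.amplitude p := by
  have hs := skewNorm_sigmaStd_pos
  set s := skewNorm sigmaStd with hsdef
  let w : Plane := !₂[‖p‖, -p 0]
  have hw : ‖w‖ ^ 2 = ‖p‖ ^ 2 + p 0 ^ 2 := by
    rw [EuclideanSpace.norm_sq_eq]
    simp [w, Fin.sum_univ_two]
  have hwi : ∀ y : Plane, inner ℝ w y = ‖p‖ * y 0 - p 0 * y 1 := by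
    intro y
    simp [w, PiLp.inner_apply, Fin.sum_univ_two]
    ring
  have hsplit : ∀ x : Plane × Plane,
      Complex.exp (-Complex.I * minkowski p x) * (ω.psi x : ℂ) =
      (Complex.exp (-Complex.I * (inner ℝ w x.1 : ℝ)) *
        (((2 * Real.pi * s)⁻¹ * Real.exp (-‖x.1 - ω.center‖ ^ 2 / (2 * s)) : ℝ) : ℂ)) *
      (Complex.exp (Complex.I * (p 1 * x.2 0 + p 2 * x.2 1 : ℝ)) * (ω.profile x.2 : ℂ)) := by
    intro x
    have hm : -Complex.I * minkowski p x = -Complex.I * (inner ℝ w x.1 : ℝ) +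
        Complex.I * (p 1 * x.2 0 + p 2 * x.2 1 : ℝ) := by
      rw [hwi, minkowski]
      push_cast
      ring
    rw [hm, LocState.psi, ← hsdef, Complex.exp_add]
    push_cast
    ring
  rw [shellTransform]
  simp_rw [hsplit]
  rw [Measure.volume_eq_prod,
    integral_prod_mul (f := fun y : Plane => Complex.exp (-Complex.I * (inner ℝ w y : ℝ)) *
      (((2 * Real.pi * s)⁻¹ * Real.exp (-‖y - ω.center‖ ^ 2 / (2 * s)) : ℝ) : ℂ))
    (g := fun y : Plane => Complex.exp (Complex.I * (p 1 * y 0 + p 2 * y 1 : ℝ)) *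
      (ω.profile y : ℂ)), gaussian_integral_eq ω.center w hs, hw, LocState.amplitude, ← hsdef]
  have hphase : Complex.exp (-Complex.I * (inner ℝ w ω.center : ℝ)) = shellPhase ω.center p := by
    rw [hwi, shellPhase, minkowski]
    simp
  rw [hphase]
  push_cast
  ring

theorem amplitude_axisReflection (ω : LocState) (p : Momentum) :
    ω.amplitude (axisReflection p) = ω.amplitude p := by
  simp only [LocState.amplitude, axisReflection_zero, axisReflection_one, axisReflection_two,
    LinearIsometryEquiv.norm_map, neg_sq]

theorem conj_amplitude_transverseReflection (ω : LocState) (p : Momentum) :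
    starRingEnd ℂ (ω.amplitude (transverseReflection p)) = ω.amplitude p := by
  have h : ∀ i, transverseReflection p i = -axisReflection p i := fun _ => rfl
  simp only [LocState.amplitude, h, axisReflection_zero, axisReflection_one, axisReflection_two,
    LinearIsometryEquiv.norm_map, neg_neg, map_mul, Complex.conj_ofReal, ← integral_conj,
    ← Complex.exp_conj, Complex.conj_I]
  congr 1
  refine integral_congr_ae (Filter.Eventually.of_forall fun y => ?_)
  simp only
  congr 2
  push_cast
  ring

theorem coeFn_vector (ω : LocState) :
    ω.vector =ᵐ[shellMeasure] fun p => shellPhase ω.center p * ω.amplitude p := by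
  filter_upwards [(memLp_shellTransform_psi ω).coeFn_toLp] with p hp
  rw [← shellTransform_psi_eq]
  exact hp

theorem memLp_shellConj (ξ : Plane) (g : OneParticle) :
    MemLp (fun p => shellPhase ξ p ^ 2 * starRingEnd ℂ (g (transverseReflection p))) 2
      shellMeasure := by
  have h := (Lp.memLp g).comp_measurePreserving (measurePreserving_shell transverseReflection)
  refine h.congr_norm ?_ (Filter.Eventually.of_forall fun p => ?_)
  · exact ((continuous_shellPhase ξ).pow 2).aestronglyMeasurable.mul
      (Complex.continuous_conj.comp_aestronglyMeasurable h.1)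
  · simp [norm_shellPhase]

/-- The conjugation of the one-particle space that fixes the vectors localized at `ξ`. -/
def shellConj (ξ : Plane) (g : OneParticle) : OneParticle := (memLp_shellConj ξ g).toLp _

theorem coeFn_shellConj (ξ : Plane) (g : OneParticle) : shellConj ξ g =ᵐ[shellMeasure]
    fun p => shellPhase ξ p ^ 2 * starRingEnd ℂ (g (transverseReflection p)) :=
  (memLp_shellConj ξ g).coeFn_toLp

theorem ae_transverseReflection {P : Momentum → Prop} (h : ∀ᵐ p ∂shellMeasure, P p) :
    ∀ᵐ p ∂shellMeasure, P (transverseReflection p) :=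
  (measurePreserving_shell transverseReflection).quasiMeasurePreserving.ae h

theorem shellConj_add (ξ : Plane) (f g : OneParticle) :
    shellConj ξ (f + g) = shellConj ξ f + shellConj ξ g := by
  refine Lp.ext ?_
  filter_upwards [coeFn_shellConj ξ (f + g), coeFn_shellConj ξ f, coeFn_shellConj ξ g,
    Lp.coeFn_add (shellConj ξ f) (shellConj ξ g),
    ae_transverseReflection (Lp.coeFn_add f g)] with p h1 h2 h3 h4 h5
  rw [h1, h4, Pi.add_apply, h2, h3, h5, Pi.add_apply, map_add, mul_add]

theorem shellConj_smul (ξ : Plane) (c : ℂ) (f : OneParticle) :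
    shellConj ξ (c • f) = starRingEnd ℂ c • shellConj ξ f := by
  refine Lp.ext ?_
  filter_upwards [coeFn_shellConj ξ (c • f), coeFn_shellConj ξ f,
    Lp.coeFn_smul (starRingEnd ℂ c) (shellConj ξ f),
    ae_transverseReflection (Lp.coeFn_smul c f)] with p h1 h2 h3 h4
  rw [h1, h3, Pi.smul_apply, h2, h4, Pi.smul_apply, smul_eq_mul, smul_eq_mul, map_mul,
    mul_left_comm]

theorem shellConj_shellConj (ξ : Plane) (f : OneParticle) :
    shellConj ξ (shellConj ξ f) = f := by
  refine Lp.ext ?_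
  filter_upwards [coeFn_shellConj ξ (shellConj ξ f),
    ae_transverseReflection (coeFn_shellConj ξ f)] with p h1 h2
  rw [h1, h2, transverseReflection_transverseReflection, shellPhase_transverseReflection, map_mul,
    Complex.conj_conj, map_pow, ← mul_assoc, ← mul_pow, mul_comm (shellPhase ξ p),
    conj_shellPhase_mul_self, one_pow, one_mul]

theorem inner_shellConj (ξ : Plane) (f g : OneParticle) :
    (inner ℂ (shellConj ξ f) g : ℂ) = inner ℂ (shellConj ξ g) f := by
  rw [L2.inner_def, L2.inner_def, ← integral_shell_comp transverseReflection]
  refine integral_congr_ae ?_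
  filter_upwards [ae_transverseReflection (coeFn_shellConj ξ f), coeFn_shellConj ξ g]
    with p h1 h2
  rw [h1, h2, transverseReflection_transverseReflection, shellPhase_transverseReflection]
  simp only [RCLike.inner_apply, map_mul, Complex.conj_conj]
  ring

theorem shellConj_vector (ω : LocState) : shellConj ω.center ω.vector = ω.vector := by
  refine Lp.ext ?_
  filter_upwards [coeFn_shellConj ω.center ω.vector, coeFn_vector ω,
    ae_transverseReflection (coeFn_vector ω)] with p h1 h2 h3
  rw [h1, h2, h3, map_mul, conj_amplitude_transverseReflection, shellPhase_transverseReflection]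
  linear_combination (shellPhase ω.center p * ω.amplitude p) *
    conj_shellPhase_mul_self ω.center p

theorem memLp_oddVector (ξ : Plane) :
    MemLp (fun p : Momentum => shellPhase ξ p *
      ((Real.sin (p 0) * Real.exp (-‖p‖ ^ 2 / 2) : ℝ) : ℂ)) 2 shellMeasure := by
  have hc : Continuous fun p : Momentum => shellPhase ξ p *
      ((Real.sin (p 0) * Real.exp (-‖p‖ ^ 2 / 2) : ℝ) : ℂ) := by
    have := continuous_shellPhase ξ
    fun_prop
  rw [memLp_two_iff_integrable_sq_norm hc.aestronglyMeasurable]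
  refine (integrable_shell_gaussian one_pos).mono' (hc.norm.pow 2).aestronglyMeasurable
    (Filter.Eventually.of_forall fun p => ?_)
  rw [norm_pow, norm_norm, norm_mul, norm_shellPhase, one_mul, Complex.norm_real,
    Real.norm_eq_abs, sq_abs, mul_pow, ← Real.exp_nat_mul]
  refine (mul_le_of_le_one_left (Real.exp_pos _).le (Real.sin_sq_le_one _)).trans (le_of_eq ?_)
  congr 1
  push_cast
  ring

/-- A one-particle vector that is odd along the quantum axis, relative to the plane wave
of `ξ`. -/
def oddVector (ξ : Plane) : OneParticle := (memLp_oddVector ξ).toLp _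

theorem oddVector_ne_zero (ξ : Plane) : oddVector ξ ≠ 0 := by
  intro h
  have h0 := (memLp_oddVector ξ).coeFn_toLp.symm.trans
    ((Lp.eq_zero_iff_ae_eq_zero (f := oddVector ξ)).1 h)
  have h1 : (fun p : Momentum => Real.sin (p 0)) =ᵐ[volume] fun _ => 0 := by
    have h2 := (ae_withDensity_iff (by fun_prop)).1 h0
    filter_upwards [h2] with p hp
    rcases eq_or_ne p 0 with rfl | hp0
    · simp
    · have h3 : ENNReal.ofReal (1 / (2 * ‖p‖)) ≠ 0 :=
        (ENNReal.ofReal_pos.2 (by positivity)).ne'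
      have h4 := hp h3
      have h5 : shellPhase ξ p ≠ 0 := Complex.exp_ne_zero _
      rcases mul_eq_zero.1 h4 with h6 | h6
      · exact absurd h6 h5
      · exact (mul_eq_zero.1 (Complex.ofReal_eq_zero.1 h6)).resolve_right (Real.exp_ne_zero _)
  have h2 := congrFun ((Continuous.ae_eq_iff_eq volume (by fun_prop) continuous_const).1 h1)
    (EuclideanSpace.single 0 (Real.pi / 2))
  simp at h2

theorem inner_oddVector_vector (ω : LocState) :
    (inner ℂ (oddVector ω.center) ω.vector : ℂ) = 0 := by
  rw [L2.inner_def]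
  have h : ∫ p, inner ℂ (oddVector ω.center p) (ω.vector p) ∂shellMeasure =
      ∫ p : Momentum, ω.amplitude p * ((Real.sin (p 0) * Real.exp (-‖p‖ ^ 2 / 2) : ℝ) : ℂ)
        ∂shellMeasure := by
    refine integral_congr_ae ?_
    filter_upwards [(memLp_oddVector ω.center).coeFn_toLp, coeFn_vector ω] with p h1 h2
    rw [oddVector, h1, h2, RCLike.inner_apply, map_mul, Complex.conj_ofReal]
    linear_combination (ω.amplitude p *
      ((Real.sin (p 0) * Real.exp (-‖p‖ ^ 2 / 2) : ℝ) : ℂ)) *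
      conj_shellPhase_mul_self ω.center p
  rw [h]
  have hodd := integral_shell_comp axisReflection fun p : Momentum =>
    ω.amplitude p * ((Real.sin (p 0) * Real.exp (-‖p‖ ^ 2 / 2) : ℝ) : ℂ)
  simp only [amplitude_axisReflection, axisReflection_zero, LinearIsometryEquiv.norm_map,
    Real.sin_neg, neg_mul, Complex.ofReal_neg, mul_neg, integral_neg] at hodd
  exact self_eq_neg.1 hodd.symm

theorem center_eq_of_supp_subset {ω : LocState} {ξ : Plane} {D : Set Plane}
    (h : ω.supp ⊆ {ξ} ×ˢ D) : ω.center = ξ := by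
  have hne : ω.profile ≠ 0 := fun h0 => by simpa [h0] using ω.integral_eq_one
  obtain ⟨y, hy⟩ := Function.ne_iff.1 hne
  exact (h (show (ω.center, y) ∈ ω.supp from
    ⟨rfl, subset_tsupport _ (Function.mem_support.2 hy)⟩)).1

end OneParticle

end ScaleCov

end

theorem mainTheorem3 (R : ScaleCov.Region) :
    ScaleCov.IsSeparatingVector (ScaleCov.fieldAlgebra R.proj)
        (ScaleCov.vacuum ScaleCov.shellMeasure) ∧
      ¬ ScaleCov.IsCyclicVector (ScaleCov.fieldAlgebra R.proj)
        (ScaleCov.vacuum ScaleCov.shellMeasure) := by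
  constructor
  · refine ScaleCov.isSeparatingVector_vacuum_of_conjugation (ScaleCov.shellConj R.point)
      (ScaleCov.shellConj_add _) (ScaleCov.shellConj_smul _) (ScaleCov.shellConj_shellConj _)
      (ScaleCov.inner_shellConj _) ?_
    rintro _ ⟨ω, hω, rfl⟩
    rw [← ScaleCov.center_eq_of_supp_subset hω, ScaleCov.shellConj_vector]
  · refine ScaleCov.not_isCyclicVector_vacuum_of_orthogonal
      (ScaleCov.oddVector_ne_zero R.point) ?_
    rintro _ ⟨ω, hω, rfl⟩
    rw [← ScaleCov.center_eq_of_supp_subset hω, ScaleCov.inner_oddVector_vector]
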